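/- Let $\mathbb{R}^d$ be equipped with an arbitrary norm $\|\cdot\|$ (equivalently, work in any finite-dimensional real normed space), and let $\operatorname{dist}(x,Q)=\inf_{y\in Q}\|x-y\|$. A set is called polyhedral if it is the intersection of finitely many closed half-spaces. A function $f\colon\mathbb{R}^d\to\mathbb{R}$ is called piecewise affine if there are finitely many polyhedral sets $Q_1,\dots,Q_s$ with nonempty, pairwise disjoint interiors and $\bigcup_{i=1}^s Q_i=\mathbb{R}^d$, and affine functions $g_1,\dots,g_s\colon\mathbb{R}^d\to\mathbb{R}$, such that $f(x)=g_i(x)$ for all $x\in Q_i$ and all $i$. For $g\colon\mathbb{R}^d\to\mathbb{R}$ put $S(g)=\{x\mid g(x)\le 0\}$ and $[g]_+(x)=\max\{g(x),0\}$, and let $g^\infty(x)=\lim_{\lambda\to+\infty}g(\lambda x)/\lambda$ be the recession function of $g$, wherever this limit exists. For a set $Q\subseteq\mathbb{R}^d$ let $0^+Q$ be the set of all $z$ for which there is $x\in Q$ with $x+\lambda z\in Q$ for all $\lambda\ge 0$ (so that $0^+\emptyset=\emptyset$). One says that $f$ has an error bound on $V$ if there is $\tau>0$ such that $\tau\operatorname{dist}(x,S(f))\le[f]_+(x)$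 for all $x\in V$. **Theorem.** Let $f\colon\mathbb{R}^d\to\mathbb{R}$ be piecewise affine with $S(f)$ nonempty, and let $V\subseteq\mathbb{R}^d$ be a finite union of polyhedral sets. Then the limit defining $[f]_+^\infty(x)$ exists in $\mathbb{R}$ for every $x\in\mathbb{R}^d$, and $f$ has an error bound on $V$ if and only if $$S([f]_+^\infty)\cap 0^+V\subseteq 0^+S(f).$$ -/

import Mathlib

open Filter Topology

namespace PAErrorBound

/-- A polyhedral set: a finite intersection of closed half-spaces `{x | ℓ x ≤ b}`, i.e. the solution
set of a finite system of (non-strict) linear inequalities. Zero functionals `ℓ` are permitted; they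
contribute only the whole space or the empty set. -/
def IsPolyhedral {E : Type*} [AddCommGroup E] [Module ℝ E] (Q : Set E) : Prop :=
  ∃ (m : ℕ) (ℓ : Fin m → (E →ₗ[ℝ] ℝ)) (b : Fin m → ℝ), Q = {x | ∀ k, ℓ k x ≤ b k}

/-- A finite union of polyhedral sets. -/
def IsFiniteUnionPolyhedral {E : Type*} [AddCommGroup E] [Module ℝ E] (V : Set E) : Prop :=
  ∃ (n : ℕ) (P : Fin n → Set E), (∀ i, IsPolyhedral (P i)) ∧ V = ⋃ i, P i

/-- A polyhedral partition of the space: finitely many polyhedral sets with nonempty and pairwise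
disjoint interiors whose union is the whole space. -/
structure IsPolyhedralPartition {E : Type*} [NormedAddCommGroup E] [NormedSpace ℝ E]
    {s : ℕ} (Q : Fin s → Set E) : Prop where
  polyhedral : ∀ i, IsPolyhedral (Q i)
  iUnion_eq : ⋃ i, Q i = Set.univ
  interior_nonempty : ∀ i, (interior (Q i)).Nonempty
  interior_disjoint : ∀ i j, i ≠ j → interior (Q i) ∩ interior (Q j) = ∅

/-- A piecewise affine real-valued function: affine on each member of some polyhedral partition. -/
def IsPiecewiseAffine {E : Type*} [NormedAddCommGroup E] [NormedSpace ℝ E] (f : E → ℝ) : Prop :=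
  ∃ (s : ℕ) (Q : Fin s → Set E) (g : Fin s → (E →ᵃ[ℝ] ℝ)),
    IsPolyhedralPartition Q ∧ ∀ i, ∀ x ∈ Q i, f x = g i x

/-- The lower `0`-level set `S(f) = {x | f x ≤ 0}`. -/
def zeroSublevel {E : Type*} (f : E → ℝ) : Set E := {x | f x ≤ 0}

/-- The positive part `[f]₊(x) = max {f x, 0}`. -/
def positivePart {E : Type*} (f : E → ℝ) : E → ℝ := fun x => max (f x) 0

/-- The recession cone `0⁺Q`: all `z` such that `Q` contains some ray `{x + t z | t ≥ 0}`, `x ∈ Q`. -/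
def recessionCone {E : Type*} [AddCommGroup E] [Module ℝ E] (Q : Set E) : Set E :=
  {z | ∃ x ∈ Q, ∀ t : ℝ, 0 ≤ t → x + t • z ∈ Q}

/-- The recession function `f^∞(x) = lim_{t → +∞} f(t x) / t`. -/
noncomputable def recessionFunction {E : Type*} [AddCommGroup E] [Module ℝ E]
    (f : E → ℝ) : E → ℝ :=
  fun x => limUnder atTop (fun t : ℝ => f (t • x) / t)

/-- `f` has an error bound on `V`: for some `τ > 0`, `τ · dist(x, S(f)) ≤ [f]₊(x)` on `V`. -/
def HasErrorBoundOn {E : Type*} [NormedAddCommGroup E] (f : E → ℝ) (V : Set E) : Prop :=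
  ∃ τ : ℝ, 0 < τ ∧ ∀ x ∈ V, τ * Metric.infDist x (zeroSublevel f) ≤ positivePart f x

end PAErrorBound

namespace PAErrorBound

/-! Along a ray with direction z, f is eventually affine, and since f is Lipschitz its asymptotic
slope s(z) does not depend on the base point. Hence the recession function of the positive part is
max(s, 0), and its sublevel condition is s(z) ≤ 0.

Necessity: on a ray in V with s(z) ≤ 0, f stays bounded above, so the error bound keeps the ray at
bounded distance from S(f), a finite union of polyhedra. One of them is near the ray at arbitrarily
large times, which forces z to be one of its recession directions.

Sufficiency: V splits into finitely many polyhedra W on which f is an affine function a. If a ≤ 0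
somewhere on W, Hoffman's bound suffices (`hoffmanProperty`). Otherwise Hoffman's bound for
unsolvable systems gives a ≥ δ > 0 on W, so additive constants can be absorbed. Hoffman's bound for
the homogeneous system moves x to a recession direction z of W with nonpositive slope, at distance
O(a(x)). The inclusion puts z in 0⁺S(f), which lies within bounded distance of S(f). -/

/-- Hoffman's error bound for finite systems of linear inequalities `ℓ k x ≤ b k` on `F`: an
approximate solution with residual `r` is within `C * r` of an exact one, provided that the system
is solvable or `r` is below a positive threshold. In particular, the residuals of an unsolvable
system are bounded away from zero. -/
def HoffmanProperty (F : Type*) [NormedAddCommGroup F] [NormedSpace ℝ F] : Prop :=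
  ∀ (ι : Type) [Finite ι] (ℓ : ι → (F →ₗ[ℝ] ℝ)) (b : ι → ℝ), ∃ C δ : ℝ, 0 ≤ C ∧ 0 < δ ∧
    ∀ (x : F) (r : ℝ), 0 ≤ r → (r < δ ∨ ∃ y, ∀ k, ℓ k y ≤ b k) → (∀ k, ℓ k x ≤ b k + r) →
      ∃ y, (∀ k, ℓ k y ≤ b k) ∧ ‖x - y‖ ≤ C * r

/-! ### Hoffman's error bound, by induction on the dimension. -/

theorem exists_forall_le_of_finite {ι : Type*} [Finite ι] (u : ι → ℝ) : ∃ M, ∀ i, u i ≤ M := by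
  obtain ⟨M, hM⟩ := (Set.finite_range u).bddAbove
  exact ⟨M, fun i => hM ⟨i, rfl⟩⟩

/-- One-dimensional Helly theorem for finitely many half-lines and a bounded interval. -/
theorem exists_between_near {α β : Type*} [Finite α] [Finite β] (l : α → ℝ) (u : β → ℝ) (t ρ : ℝ)
    (hρ : 0 ≤ ρ) (hlu : ∀ i j, l i ≤ u j) (hl : ∀ i, l i ≤ t + ρ) (hu : ∀ j, t - ρ ≤ u j) :
    ∃ s, (∀ i, l i ≤ s) ∧ (∀ j, s ≤ u j) ∧ |t - s| ≤ ρ := by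
  -- `none` adjoins t - ρ as one more lower bound; s is the largest lower bound.
  obtain ⟨i, hi⟩ := Finite.exists_max (fun o : Option α => o.elim (t - ρ) l)
  have hnone := hi none
  have hsome : ∀ a, l a ≤ (i.elim (t - ρ) l) := fun a => hi (some a)
  simp only [Option.elim_none] at hnone
  refine ⟨i.elim (t - ρ) l, hsome, fun j => ?_, abs_le.2 ⟨?_, by linarith⟩⟩
  · cases i with
    | none => exact hu j
    | some a => exact hlu a j
  · cases i with
    | none => simp only [Option.elim_none]; linarith
    | some a => have := hl a; simp only [Option.elim_some]; linarith

theorem hoffmanProperty_of_subsingleton (F : Type*) [NormedAddCommGroup F] [NormedSpace ℝ F]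
    [Subsingleton F] : HoffmanProperty F := by
  intro ι _ ℓ b
  by_cases h : ∀ k, ℓ k 0 ≤ b k
  · refine ⟨0, 1, le_rfl, one_pos, fun x r hr _ _ => ⟨0, h, ?_⟩⟩
    simp [Subsingleton.elim x 0]
  · push Not at h
    obtain ⟨k, hk⟩ := h
    refine ⟨0, ℓ k 0 - b k, le_rfl, by linarith, fun x r hr hor hx => ?_⟩
    exfalso
    rcases hor with h | ⟨y, hy⟩
    · have := hx k
      rw [Subsingleton.elim x 0] at this
      linarith
    · have := hy k
      rw [Subsingleton.elim y 0] at this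
      linarith

theorem HoffmanProperty.of_equiv {F G : Type*} [NormedAddCommGroup F] [NormedSpace ℝ F]
    [NormedAddCommGroup G] [NormedSpace ℝ G] (hF : HoffmanProperty F) (e : F ≃L[ℝ] G) :
    HoffmanProperty G := by
  intro ι _ ℓ b
  obtain ⟨C, δ, hC, hδ, H⟩ := hF ι (fun k => ℓ k ∘ₗ (e : F →ₗ[ℝ] G)) b
  refine ⟨‖(e : F →L[ℝ] G)‖ * C, δ, by positivity, hδ, fun x r hr hor hx => ?_⟩
  obtain ⟨y, hy, hxy⟩ := H (e.symm x) r hr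
    (hor.imp_right fun ⟨y, hy⟩ => ⟨e.symm y, by simpa using hy⟩) (by simpa using hx)
  refine ⟨e y, hy, ?_⟩
  have h1 := (e : F →L[ℝ] G).le_opNorm (e.symm x - y)
  have h2 : (e : F →L[ℝ] G) (e.symm x - y) = x - e y := by simp
  rw [h2] at h1
  calc ‖x - e y‖ ≤ _ := h1
    _ ≤ ‖(e : F →L[ℝ] G)‖ * (C * r) := by gcongr
    _ = _ := by ring

theorem exists_norm_bound_of_finite {F : Type*} [NormedAddCommGroup F] [NormedSpace ℝ F]
    [FiniteDimensional ℝ F] {ι : Type*} [Finite ι] (m : ι → (F →ₗ[ℝ] ℝ)) :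
    ∃ L, 0 ≤ L ∧ ∀ k x, |m k x| ≤ L * ‖x‖ := by
  obtain ⟨L, hL⟩ := exists_forall_le_of_finite fun k => ‖LinearMap.toContinuousLinearMap (m k)‖
  refine ⟨max L 0, le_max_right _ _, fun k x => ?_⟩
  have h := (LinearMap.toContinuousLinearMap (m k)).le_opNorm x
  simp only [LinearMap.coe_toContinuousLinearMap', Real.norm_eq_abs] at h
  refine h.trans ?_
  gcongr
  exact (hL k).trans (le_max_left _ _)

/-- Fourier–Motzkin elimination of the first coordinate. -/
theorem HoffmanProperty.prod {F : Type*} [NormedAddCommGroup F] [NormedSpace ℝ F]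
    [FiniteDimensional ℝ F] (hF : HoffmanProperty F) : HoffmanProperty (ℝ × F) := by
  intro ι _ ℓ b
  set c : ι → ℝ := fun k => ℓ k (1, 0) with hc
  set m : ι → (F →ₗ[ℝ] ℝ) := fun k => ℓ k ∘ₗ LinearMap.inr ℝ ℝ F with hm
  have hℓ : ∀ k t x, ℓ k (t, x) = c k * t + m k x := by
    intro k t x
    have : ((t, x) : ℝ × F) = t • (1, 0) + (0, x) := by simp
    rw [this, map_add, map_smul]
    simp [hc, hm, mul_comm]
  obtain ⟨L, hL0, hL⟩ := exists_norm_bound_of_finite m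
  obtain ⟨M', hM'⟩ := exists_forall_le_of_finite fun k => |(c k)⁻¹|
  obtain ⟨M, hM1, hM⟩ : ∃ M, 1 ≤ M ∧ ∀ k, |(c k)⁻¹| ≤ M :=
    ⟨max 1 M', le_max_left _ _, fun k => (hM' k).trans (le_max_right _ _)⟩
  -- For c k ≠ 0, `u k x` is the first coordinate at which constraint k is tight: an upper bound if
  -- c k > 0, a lower bound if c k < 0.
  let u : ι → F → ℝ := fun k x => (c k)⁻¹ * (b k - m k x)
  have hu : ∀ k x y, u k x - u k y ≤ M * L * ‖x - y‖ := by
    intro k x y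
    have h1 : u k x - u k y = (c k)⁻¹ * m k (y - x) := by simp only [u, map_sub]; ring
    rw [h1]
    refine (le_abs_self _).trans ?_
    rw [abs_mul, mul_assoc, norm_sub_rev]
    exact mul_le_mul (hM k) (hL k _) (abs_nonneg _) (by linarith)
  let A := {k // c k = 0}
  let P := {k // 0 < c k}
  let N := {k // c k < 0}
  -- The eliminated system: the constraints free of the first coordinate, and every lower bound `u
  -- j` at most every upper bound `u i`.
  obtain ⟨C, δ, hC, hδ, H⟩ := hF (A ⊕ P × N)
    (Sum.elim (fun k => m k) (fun ij => (c ij.1)⁻¹ • m ij.1 - (c ij.2)⁻¹ • m ij.2))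
    (Sum.elim (fun k => b k) (fun ij => (c ij.1)⁻¹ * b ij.1 - (c ij.2)⁻¹ * b ij.2))
  simp only [Sum.forall, Sum.elim_inl, Sum.elim_inr, Prod.forall, LinearMap.sub_apply,
    LinearMap.smul_apply, smul_eq_mul] at H
  have hP : ∀ (i : P) (r t : ℝ) (x : F), ℓ i (t, x) ≤ b i + r ↔ t ≤ u i x + (c i)⁻¹ * r := by
    intro i r t x
    have hi : 0 < c i := i.2
    rw [hℓ, show u i x + (c i)⁻¹ * r = (b i + r - m i x) / c i by simp only [u]; ring,
      le_div_iff₀ hi]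
    constructor <;> intro h <;> linarith
  have hN : ∀ (i : N) (r t : ℝ) (x : F), ℓ i (t, x) ≤ b i + r ↔ u i x + (c i)⁻¹ * r ≤ t := by
    intro i r t x
    have hi : c i < 0 := i.2
    rw [hℓ, show u i x + (c i)⁻¹ * r = (b i + r - m i x) / c i by simp only [u]; ring,
      div_le_iff_of_neg hi]
    constructor <;> intro h <;> linarith
  have hMr : ∀ k r, 0 ≤ r → |(c k)⁻¹ * r| ≤ M * r := by
    intro k r hr
    rw [abs_mul, abs_of_nonneg hr]
    exact mul_le_mul_of_nonneg_right (hM k) hr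
  -- A residual r costs at most M * r in each of the two bounds compared, hence 2 * M * r; M ≥ 1
  -- covers the constraints in A. With r = 0 this says that solvability survives elimination.
  have key : ∀ (t : ℝ) (x : F) (r : ℝ), 0 ≤ r → (∀ k, ℓ k (t, x) ≤ b k + r) →
      (∀ k : A, m k x ≤ b k + 2 * M * r) ∧ ∀ (i : P) (j : N),
        (c i)⁻¹ * m i x - (c j)⁻¹ * m j x ≤ (c i)⁻¹ * b i - (c j)⁻¹ * b j + 2 * M * r := by
    intro t x r hr h
    refine ⟨fun k => ?_, fun i j => ?_⟩
    · have h1 := h k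
      rw [hℓ, show c k = 0 from k.2] at h1
      nlinarith
    · have h1 := (hP i r t x).1 (h i)
      have h2 := (hN j r t x).1 (h j)
      have h3 := abs_le.1 (hMr i r hr)
      have h4 := abs_le.1 (hMr j r hr)
      simp only [u] at h1 h2
      linarith
  have hM0 : 0 < M := by linarith
  refine ⟨C * (2 * M) + (M + M * L * (C * (2 * M))), δ / (2 * M), by positivity, by positivity,
    fun ⟨t, x⟩ r hr hor hx => ?_⟩
  obtain ⟨y, ⟨hyA, hyPN⟩, hxy⟩ := H x (2 * M * r) (by positivity)
    (hor.imp (fun h => by rwa [lt_div_iff₀' (by positivity)] at h)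
      (fun ⟨⟨s, y⟩, hy⟩ => ⟨y, by simpa using key s y 0 le_rfl (by simpa using hy)⟩))
    (key t x r hr hx)
  have hxy' : M * L * ‖x - y‖ ≤ M * L * (C * (2 * M * r)) := by gcongr
  -- The radius adds the residual of the bounds at x and their change from x to y.
  obtain ⟨s, hsN, hsP, hs⟩ := exists_between_near (fun j : N => u j y) (fun i : P => u i y) t
    (M * r + M * L * (C * (2 * M * r))) (by positivity)
    (fun j i => by
      have := hyPN i j
      simp only [u]; linarith)
    (fun j => by
      have h1 := (hN j r t x).1 (hx j)
      have h2 := hu j y x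
      rw [norm_sub_rev] at h2
      have h3 := abs_le.1 (hMr j r hr)
      linarith)
    (fun i => by
      have h1 := (hP i r t x).1 (hx i)
      have h2 := hu i x y
      have h3 := abs_le.1 (hMr i r hr)
      linarith)
  refine ⟨(s, y), fun k => ?_, ?_⟩
  · rcases lt_trichotomy (c k) 0 with hk | hk | hk
    · simpa using (hN ⟨k, hk⟩ 0 s y).2 (by simpa using hsN ⟨k, hk⟩)
    · rw [hℓ, hk]
      simpa using hyA ⟨k, hk⟩
    · simpa using (hP ⟨k, hk⟩ 0 s y).2 (by simpa using hsP ⟨k, hk⟩)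
  · have h0 : 0 ≤ C * (2 * M * r) := by positivity
    have h1 : 0 ≤ M * r + M * L * (C * (2 * M * r)) := by positivity
    rw [Prod.mk_sub_mk, Prod.norm_mk, Real.norm_eq_abs]
    exact max_le (by linarith) (by linarith)

theorem hoffmanProperty_pi (n : ℕ) : HoffmanProperty (Fin n → ℝ) := by
  induction n with
  | zero => exact hoffmanProperty_of_subsingleton _
  | succ n ih =>
    exact ih.prod.of_equiv (Fin.consEquivL ℝ (fun _ : Fin (n + 1) => ℝ))

theorem hoffmanProperty (F : Type*) [NormedAddCommGroup F] [NormedSpace ℝ F]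
    [FiniteDimensional ℝ F] : HoffmanProperty F :=
  (hoffmanProperty_pi (Module.finrank ℝ F)).of_equiv
    (ContinuousLinearEquiv.ofFinrankEq (by simp))

/-! ### Polyhedral sets, affine functions and rays. -/

theorem exists_frequently_of_finite {α ι : Type*} [Finite ι] {F : Filter α} {p : ι → α → Prop}
    (h : ∃ᶠ t in F, ∃ i, p i t) : ∃ i, ∃ᶠ t in F, p i t := by
  by_contra! H
  refine h ?_
  filter_upwards [eventually_all.2 H] with t ht ⟨i, hi⟩
  exact ht i hi

section Algebra

variable {E : Type*} [AddCommGroup E] [Module ℝ E]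

theorem IsPolyhedral.convex {P : Set E} (hP : IsPolyhedral P) : Convex ℝ P := by
  obtain ⟨m, ℓ, b, rfl⟩ := hP
  rw [Set.ofPred_forall]
  exact convex_iInter fun k => convex_halfSpace_le (ℓ k).isLinear (b k)

theorem IsPolyhedral.inter {P Q : Set E} (hP : IsPolyhedral P) (hQ : IsPolyhedral Q) :
    IsPolyhedral (P ∩ Q) := by
  obtain ⟨m, ℓ, b, rfl⟩ := hP
  obtain ⟨n, ℓ', b', rfl⟩ := hQ
  refine ⟨m + n, Fin.append ℓ ℓ', Fin.append b b', ?_⟩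
  ext x
  simp only [Set.mem_inter_iff, Set.mem_ofPred_eq]
  constructor
  · rintro ⟨h, h'⟩ k
    refine Fin.addCases (fun i => ?_) (fun i => ?_) k
    · simpa using h i
    · simpa using h' i
  · intro h
    exact ⟨fun i => by simpa using h (Fin.castAdd n i), fun i => by simpa using h (Fin.natAdd m i)⟩

theorem affineMap_apply_eq (g : E →ᵃ[ℝ] ℝ) (x : E) : g x = g.linear x + g 0 := by
  simpa using g.map_vadd 0 x

theorem affineMap_apply_ray (g : E →ᵃ[ℝ] ℝ) (x z : E) (t : ℝ) :
    g (x + t • z) = g x + t * g.linear z := by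
  rw [affineMap_apply_eq g, affineMap_apply_eq g x, map_add, map_smul, smul_eq_mul]
  ring

theorem isPolyhedral_affine_le_zero (g : E →ᵃ[ℝ] ℝ) : IsPolyhedral {x | g x ≤ 0} := by
  refine ⟨1, fun _ => g.linear, fun _ => -g 0, ?_⟩
  ext x
  simp only [Set.mem_ofPred_eq, forall_const, affineMap_apply_eq g x]
  constructor <;> intro h <;> linarith

theorem ray_mem_of_forall_le_zero {ι : Type*} {ℓ : ι → (E →ₗ[ℝ] ℝ)} {b : ι → ℝ} {x z : E}
    (hx : ∀ k, ℓ k x ≤ b k) (hz : ∀ k, ℓ k z ≤ 0) {t : ℝ} (ht : 0 ≤ t) (k : ι) :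
    ℓ k (x + t • z) ≤ b k := by
  rw [map_add, map_smul, smul_eq_mul]
  nlinarith [hx k, hz k]

theorem tendsto_positivePart_div {f : E → ℝ} {s : ℝ} {z : E}
    (h : Tendsto (fun t : ℝ => f (0 + t • z) / t) atTop (𝓝 s)) :
    Tendsto (fun t : ℝ => positivePart f (t • z) / t) atTop (𝓝 (max s 0)) := by
  refine (h.max (tendsto_const_nhds (x := (0 : ℝ)))).congr' ?_
  filter_upwards [eventually_gt_atTop 0] with t ht
  rw [positivePart, zero_add, ← max_div_div_right ht.le, zero_div]

end Algebra

variable {E : Type*} [NormedAddCommGroup E] [NormedSpace ℝ E] [FiniteDimensional ℝ E]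

theorem IsPolyhedral.isClosed {P : Set E} (hP : IsPolyhedral P) : IsClosed P := by
  obtain ⟨m, ℓ, b, rfl⟩ := hP
  rw [Set.ofPred_forall]
  exact isClosed_iInter fun k =>
    isClosed_le (ℓ k).continuous_of_finiteDimensional continuous_const

/-- A direction whose ray is asymptotically at bounded distance from a polyhedral set belongs to its
recession cone, and the base point can be chosen arbitrarily in the set. -/
theorem IsPolyhedral.ray_mem_of_frequently_near {P : Set E} (hP : IsPolyhedral P) {x z : E} {D : ℝ}
    (h : ∃ᶠ t : ℝ in atTop, ∃ y ∈ P, ‖x + t • z - y‖ ≤ D) {p : E} (hp : p ∈ P) {t : ℝ}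
    (ht : 0 ≤ t) : p + t • z ∈ P := by
  obtain ⟨m, ℓ, b, rfl⟩ := hP
  refine ray_mem_of_forall_le_zero hp (fun k => ?_) ht
  by_contra! hk
  obtain ⟨L, hL0, hL⟩ := exists_norm_bound_of_finite ℓ
  -- If ℓ k z > 0, then ℓ k grows without bound along the ray, yet nearness to the set keeps it
  -- below b k + L * D at arbitrarily large times.
  obtain ⟨t, ⟨y, hy, hyD⟩, htk⟩ := (h.and_eventually
    (eventually_gt_atTop ((b k + L * D - ℓ k x) / ℓ k z))).exists
  rw [div_lt_iff₀ hk] at htk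
  have h1 := (le_abs_self _).trans (hL k (x + t • z - y))
  rw [map_sub, map_add, map_smul, smul_eq_mul] at h1
  have h2 : L * ‖x + t • z - y‖ ≤ L * D := by gcongr
  have h3 := hy k
  linarith

theorem IsPolyhedral.ray_mem_of_frequently {P : Set E} (hP : IsPolyhedral P) {x z : E}
    (h : ∃ᶠ t : ℝ in atTop, x + t • z ∈ P) {p : E} (hp : p ∈ P) {t : ℝ}
    (ht : 0 ≤ t) : p + t • z ∈ P :=
  hP.ray_mem_of_frequently_near (x := x) (D := 0)
    (h.mono fun _ hs => ⟨_, hs, by simp⟩) hp ht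

theorem IsPolyhedral.eventually_of_frequently {P : Set E} (hP : IsPolyhedral P) {x z : E}
    (h : ∃ᶠ t : ℝ in atTop, x + t • z ∈ P) : ∀ᶠ t : ℝ in atTop, x + t • z ∈ P := by
  obtain ⟨t₀, ht₀⟩ := h.exists
  filter_upwards [eventually_ge_atTop t₀] with t ht
  have := hP.ray_mem_of_frequently h ht₀ (sub_nonneg.2 ht)
  rwa [add_assoc, ← add_smul, add_sub_cancel] at this

/-- A finite union of polyhedral sets is at bounded distance from its recession cone. -/
theorem exists_infDist_le_of_recessionCone {ι : Type*} [Finite ι] {P : ι → Set E}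
    (hP : ∀ i, IsPolyhedral (P i)) :
    ∃ D, 0 ≤ D ∧ ∀ z ∈ recessionCone (⋃ i, P i), Metric.infDist z (⋃ i, P i) ≤ D := by
  classical
  choose p hp using fun i : {i // (P i).Nonempty} => i.2
  obtain ⟨D, hD⟩ := exists_forall_le_of_finite fun i => ‖p i‖
  refine ⟨max D 0, le_max_right _ _, ?_⟩
  rintro z ⟨x, -, hx⟩
  -- Some P i meets the ray at arbitrarily large times, so p i + z lies in P i, at distance ‖p i‖
  -- from z.
  obtain ⟨i, hi⟩ := exists_frequently_of_finite
    (((eventually_ge_atTop (0 : ℝ)).mono fun t ht => Set.mem_iUnion.1 (hx t ht)).frequently)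
  have hne : (P i).Nonempty := hi.exists.elim fun t ht => ⟨_, ht⟩
  have h1 := (hP i).ray_mem_of_frequently hi (hp ⟨i, hne⟩) zero_le_one
  refine (Metric.infDist_le_dist_of_mem (Set.mem_iUnion_of_mem i h1)).trans ?_
  rw [dist_eq_norm]
  simpa using Or.inl (hD ⟨i, hne⟩)

/-! ### Growth of piecewise affine functions. -/

variable {f : E → ℝ} {ι : Type*} [Finite ι] {Q : ι → Set E} {g : ι → (E →ᵃ[ℝ] ℝ)}

theorem continuous_of_polyhedral_pieces (hQ : ∀ i, IsPolyhedral (Q i)) (hU : ⋃ i, Q i = Set.univ)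
    (hg : ∀ i, ∀ x ∈ Q i, f x = g i x) : Continuous f :=
  (locallyFinite_of_finite Q).continuous hU (fun i => (hQ i).isClosed) fun i =>
    (g i).continuous_of_finiteDimensional.continuousOn.congr (hg i)

/-- Some piece meets the line at times arbitrarily close to s from the right. Being closed and
convex, it contains a whole segment starting at time s, on which f is affine. -/
theorem exists_hasDerivWithinAt_ray (hQ : ∀ i, IsPolyhedral (Q i)) (hU : ⋃ i, Q i = Set.univ)
    (hg : ∀ i, ∀ x ∈ Q i, f x = g i x) (x z : E) (s : ℝ) :
    ∃ i, HasDerivWithinAt (fun t : ℝ => f (x + t • z)) ((g i).linear z) (Set.Ici s) s := by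
  obtain ⟨i, hi⟩ := exists_frequently_of_finite (F := 𝓝[>] s) (p := fun i t => x + t • z ∈ Q i)
    (Eventually.of_forall fun t => Set.mem_iUnion.1 (hU ▸ Set.mem_univ (x + t • z))).frequently
  let γ : ℝ →ᵃ[ℝ] E := AffineMap.lineMap x (x + z)
  have hγ : ∀ t, γ t = x + t • z := fun t => by simp [γ, AffineMap.lineMap_apply, add_comm]
  have hγc : Continuous γ := γ.continuous_of_finiteDimensional
  have hcl : IsClosed (γ ⁻¹' Q i) := (hQ i).isClosed.preimage hγc
  have hcv : Convex ℝ (γ ⁻¹' Q i) := (hQ i).convex.affine_preimage γ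
  have hi' : ∃ᶠ t in 𝓝[>] s, t ∈ γ ⁻¹' Q i := hi.mono fun t ht => by simpa [hγ] using ht
  have hs : s ∈ γ ⁻¹' Q i :=
    hcl.mem_of_frequently_of_tendsto hi' (tendsto_id.mono_left nhdsWithin_le_nhds)
  obtain ⟨t₁, ht₁, hst₁⟩ := (hi'.and_eventually self_mem_nhdsWithin).exists
  have heq : ∀ t ∈ Set.Icc s t₁, f (x + t • z) = g i x + t * (g i).linear z := by
    intro t ht
    have : t ∈ γ ⁻¹' Q i := hcv.ordConnected.out hs ht₁ ht
    rw [Set.mem_preimage, hγ] at this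
    rw [hg i _ this, affineMap_apply_ray]
  refine ⟨i, ?_⟩
  have hd : HasDerivWithinAt (fun t : ℝ => g i x + t * (g i).linear z) ((g i).linear z)
      (Set.Ici s) s := by
    simpa using (((hasDerivAt_id s).mul_const ((g i).linear z)).const_add (g i x)).hasDerivWithinAt
  refine hd.congr_of_eventuallyEq ?_ (heq s ⟨le_rfl, le_of_lt hst₁⟩)
  filter_upwards [Icc_mem_nhdsGE hst₁] with t ht using heq t ht

/-- A piecewise affine function is Lipschitz. -/
theorem exists_lipschitz_of_polyhedral_pieces (hQ : ∀ i, IsPolyhedral (Q i))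
    (hU : ⋃ i, Q i = Set.univ) (hg : ∀ i, ∀ x ∈ Q i, f x = g i x) :
    ∃ L, ∀ x y, |f x - f y| ≤ L * ‖x - y‖ := by
  obtain ⟨L, -, hL⟩ := exists_norm_bound_of_finite fun i => (g i).linear
  refine ⟨L, fun y x => ?_⟩
  choose i hi using exists_hasDerivWithinAt_ray hQ hU hg x (y - x)
  have hf := continuous_of_polyhedral_pieces hQ hU hg
  -- Mean value inequality: every right derivative along the segment is the slope of one of finitely
  -- many pieces.
  have := norm_image_sub_le_of_norm_deriv_right_le_segment (a := 0) (b := 1)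
    (f := fun t : ℝ => f (x + t • (y - x))) (f' := fun s => (g (i s)).linear (y - x))
    (C := L * ‖y - x‖) (by fun_prop) (fun s _ => hi s) (fun s _ => hL _ _) 1 (by simp)
  simpa using this

/-- Along every ray, a piecewise affine function is eventually affine. -/
theorem exists_eventually_eq_affine (hQ : ∀ i, IsPolyhedral (Q i))
    (hU : ⋃ i, Q i = Set.univ) (hg : ∀ i, ∀ x ∈ Q i, f x = g i x) (x z : E) :
    ∃ α β : ℝ, ∀ᶠ t : ℝ in atTop, f (x + t • z) = α + t * β := by
  obtain ⟨i, hi⟩ := exists_frequently_of_finite (F := atTop) (p := fun i t => x + t • z ∈ Q i)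
    (Eventually.of_forall fun t : ℝ =>
      Set.mem_iUnion.1 (hU ▸ Set.mem_univ (x + t • z))).frequently
  refine ⟨g i x, (g i).linear z, ((hQ i).eventually_of_frequently hi).mono fun t ht => ?_⟩
  rw [hg i _ ht, affineMap_apply_ray]

theorem tendsto_div_atTop_of_eventually_eq_affine {φ : ℝ → ℝ} {α β : ℝ}
    (h : ∀ᶠ t in atTop, φ t = α + t * β) : Tendsto (fun t => φ t / t) atTop (𝓝 β) := by
  have h1 : Tendsto (fun t : ℝ => α / t + β) atTop (𝓝 (0 + β)) :=
    (tendsto_const_nhds.div_atTop tendsto_id).add_const β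
  rw [zero_add] at h1
  refine h1.congr' ?_
  filter_upwards [h, eventually_gt_atTop 0] with t ht ht0
  rw [ht]
  field_simp

/-- The asymptotic slope of a piecewise affine function does not depend on the base point. -/
theorem exists_tendsto_ray_div (hQ : ∀ i, IsPolyhedral (Q i))
    (hU : ⋃ i, Q i = Set.univ) (hg : ∀ i, ∀ x ∈ Q i, f x = g i x) (z : E) :
    ∃ s : ℝ, ∀ x, Tendsto (fun t : ℝ => f (x + t • z) / t) atTop (𝓝 s) := by
  obtain ⟨L, hL⟩ := exists_lipschitz_of_polyhedral_pieces hQ hU hg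
  obtain ⟨α, s, hs⟩ := exists_eventually_eq_affine hQ hU hg 0 z
  refine ⟨s, fun x => ?_⟩
  have h0 := tendsto_div_atTop_of_eventually_eq_affine hs
  -- Changing the base point alters f by at most L * ‖x‖, which vanishes after division by t.
  have h1 : Tendsto (fun t : ℝ => (f (x + t • z) - f (0 + t • z)) / t) atTop (𝓝 0) := by
    refine squeeze_zero_norm' (a := fun t : ℝ => L * ‖x‖ / t) ?_
      (tendsto_const_nhds.div_atTop tendsto_id)
    filter_upwards [eventually_gt_atTop 0] with t ht
    rw [norm_div, Real.norm_eq_abs, Real.norm_eq_abs, abs_of_pos ht]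
    gcongr
    simpa using hL (x + t • z) (0 + t • z)
  simpa [← add_div] using h1.add h0

theorem zeroSublevel_eq_iUnion {E ι : Type*} [AddCommGroup E] [Module ℝ E] {f : E → ℝ}
    {Q : ι → Set E} {g : ι → (E →ᵃ[ℝ] ℝ)} (hU : ⋃ i, Q i = Set.univ)
    (hg : ∀ i, ∀ x ∈ Q i, f x = g i x) :
    zeroSublevel f = ⋃ i, Q i ∩ {x | g i x ≤ 0} := by
  ext x
  simp only [zeroSublevel, Set.mem_ofPred_eq, Set.mem_iUnion, Set.mem_inter_iff]
  constructor
  · intro hx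
    obtain ⟨i, hi⟩ := Set.mem_iUnion.1 (hU ▸ Set.mem_univ x)
    exact ⟨i, hi, hg i x hi ▸ hx⟩
  · rintro ⟨i, hi, hx⟩
    exact (hg i x hi).symm ▸ hx

theorem HasErrorBoundOn.iUnion {E κ : Type*} [NormedAddCommGroup E] [Finite κ]
    {f : E → ℝ} {W : κ → Set E}
    (h : ∀ i, HasErrorBoundOn f (W i)) : HasErrorBoundOn f (⋃ i, W i) := by
  choose τ hτ H using h
  obtain ⟨M', hM'⟩ := exists_forall_le_of_finite fun i => (τ i)⁻¹
  obtain ⟨M, hM0, hM⟩ : ∃ M, 0 < M ∧ ∀ i, (τ i)⁻¹ ≤ M :=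
    ⟨max M' 1, by positivity, fun i => (hM' i).trans (le_max_left _ _)⟩
  refine ⟨M⁻¹, by positivity, fun x hx => ?_⟩
  obtain ⟨i, hi⟩ := Set.mem_iUnion.1 hx
  refine le_trans ?_ (H i x hi)
  exact mul_le_mul_of_nonneg_right (inv_le_of_inv_le₀ (hτ i) (hM i)) Metric.infDist_nonneg

/-! ### The two implications. -/

variable {V : Set E}

/-- If `f` has an error bound on a ray along which its asymptotic slope is nonpositive, then the
direction of this ray is a recession direction of the sublevel set. -/
theorem mem_recessionCone_of_hasErrorBoundOn (hQ : ∀ i, IsPolyhedral (Q i))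
    (hU : ⋃ i, Q i = Set.univ) (hg : ∀ i, ∀ x ∈ Q i, f x = g i x)
    (hS : (zeroSublevel f).Nonempty) (hV : HasErrorBoundOn f V) {x z : E} {s : ℝ}
    (hx : ∀ t : ℝ, 0 ≤ t → x + t • z ∈ V)
    (hs : Tendsto (fun t : ℝ => f (x + t • z) / t) atTop (𝓝 s)) (hs0 : s ≤ 0) :
    z ∈ recessionCone (zeroSublevel f) := by
  obtain ⟨τ, hτ, H⟩ := hV
  obtain ⟨α, β, hαβ⟩ := exists_eventually_eq_affine hQ hU hg x z
  have hβ : β ≤ 0 :=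
    tendsto_nhds_unique (tendsto_div_atTop_of_eventually_eq_affine hαβ) hs ▸ hs0
  have hnear : ∀ᶠ t : ℝ in atTop, ∃ i, ∃ y ∈ Q i ∩ {x | g i x ≤ 0},
      ‖x + t • z - y‖ ≤ max α 0 / τ + 1 := by
    filter_upwards [hαβ, eventually_ge_atTop 0] with t ht ht0
    have h1 : positivePart f (x + t • z) ≤ max α 0 := by
      rw [positivePart, ht]
      exact max_le_max_right 0 (by nlinarith)
    have h2 : Metric.infDist (x + t • z) (zeroSublevel f) < max α 0 / τ + 1 := by
      have := (le_div_iff₀' hτ).2 ((H _ (hx t ht0)).trans h1)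
      linarith
    obtain ⟨y, hy, hxy⟩ := (Metric.infDist_lt_iff hS).1 h2
    rw [zeroSublevel_eq_iUnion hU hg] at hy
    obtain ⟨i, hi⟩ := Set.mem_iUnion.1 hy
    exact ⟨i, y, hi, by rw [← dist_eq_norm]; exact hxy.le⟩
  obtain ⟨i, hi⟩ := exists_frequently_of_finite hnear.frequently
  obtain ⟨-, p, hp, -⟩ := hi.exists
  rw [zeroSublevel_eq_iUnion hU hg]
  exact ⟨p, Set.mem_iUnion_of_mem i hp, fun t ht => Set.mem_iUnion_of_mem i
    (((hQ i).inter (isPolyhedral_affine_le_zero _)).ray_mem_of_frequently_near hi hp ht)⟩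

/-- If `f` coincides with an affine function on a polyhedral set all of whose recession directions
of nonpositive slope are at distance at most `D` from the sublevel set, then `f` has an error bound
on this set. -/
theorem hasErrorBoundOn_of_affine_piece {W : Set E} (hW : IsPolyhedral W) {a : E →ᵃ[ℝ] ℝ}
    (ha : ∀ x ∈ W, f x = a x) {D : ℝ} (hD0 : 0 ≤ D)
    (hD : ∀ z, a.linear z ≤ 0 → (∀ x ∈ W, ∀ t : ℝ, 0 ≤ t → x + t • z ∈ W) →
      W.Nonempty → Metric.infDist z (zeroSublevel f) ≤ D) :
    HasErrorBoundOn f W := by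
  suffices h : ∃ C, 0 ≤ C ∧ ∀ x ∈ W, Metric.infDist x (zeroSublevel f) ≤ C * positivePart f x by
    obtain ⟨C, hC, h⟩ := h
    refine ⟨(C + 1)⁻¹, by positivity, fun x hx => ?_⟩
    rw [inv_mul_le_iff₀ (by positivity)]
    have h0 : 0 ≤ positivePart f x := le_max_right _ _
    linarith [h x hx]
  obtain ⟨m, ℓ, b, hWeq⟩ := hW
  have hmem : ∀ x, x ∈ W ↔ ∀ k, ℓ k x ≤ b k := fun x => by rw [hWeq]; rfl
  -- The system describes W ∩ {a ≤ 0}: `none` is the constraint a ≤ 0. At a point of W only this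
  -- constraint can be violated, so the positive part of f is an admissible residual.
  obtain ⟨C, δ, hC, hδ, H⟩ := hoffmanProperty E (Option (Fin m))
    (fun o => o.elim a.linear ℓ) (fun o => o.elim (-a 0) b)
  simp only [Option.forall, Option.elim_none, Option.elim_some, ← hmem] at H
  have hsol : ∀ y, a.linear y ≤ -a 0 ∧ y ∈ W → y ∈ zeroSublevel f := by
    rintro y ⟨hy, hyW⟩
    rw [zeroSublevel, Set.mem_ofPred_eq, ha y hyW, affineMap_apply_eq]
    linarith
  have hres : ∀ x ∈ W, ∀ r, 0 ≤ r → a x ≤ r →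
      a.linear x ≤ -a 0 + r ∧ ∀ k, ℓ k x ≤ b k + r := by
    intro x hx r hr har
    rw [affineMap_apply_eq] at har
    exact ⟨by linarith, fun k => by linarith [(hmem x).1 hx k]⟩
  by_cases hfeas : ∃ y, a.linear y ≤ -a 0 ∧ y ∈ W
  · refine ⟨C, hC, fun x hx => ?_⟩
    obtain ⟨y, hy, hxy⟩ := H x (positivePart f x) (le_max_right _ _) (Or.inr hfeas)
      (hres x hx _ (le_max_right _ _) (ha x hx ▸ le_max_left _ _))
    refine (Metric.infDist_le_dist_of_mem (hsol y hy)).trans ?_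
    rwa [dist_eq_norm]
  -- The system is now unsolvable, so its residuals are bounded below.
  have hpos : ∀ x ∈ W, δ ≤ a x := by
    intro x hx
    by_contra! hlt
    obtain ⟨y, hy, -⟩ := H x (max (a x) 0) (le_max_right _ _) (Or.inl (max_lt hlt hδ))
      (hres x hx _ (le_max_right _ _) (le_max_left _ _))
    exact hfeas ⟨y, hy⟩
  -- Homogeneous system, solved by 0: its solutions are recession directions of W along which a does
  -- not increase.
  obtain ⟨C', δ', hC', -, H'⟩ := hoffmanProperty E (Option (Fin m))
    (fun o => o.elim a.linear ℓ) (fun _ => 0)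
  simp only [Option.forall, Option.elim_none, Option.elim_some] at H'
  obtain ⟨B', hB'⟩ := exists_forall_le_of_finite b
  obtain ⟨B, hB0, hB⟩ : ∃ B, 0 ≤ B ∧ ∀ k, b k ≤ B :=
    ⟨max B' 0, le_max_right _ _, fun k => (hB' k).trans (le_max_left _ _)⟩
  -- From dist(x, S(f)) ≤ C' * (B + |a 0| + a x) + D, with the constants absorbed through 1 ≤ a x /
  -- δ.
  refine ⟨C' * ((B + |a 0|) / δ + 1) + D / δ, by positivity, fun x hx => ?_⟩
  have hax := hpos x hx
  have h0 := neg_abs_le (a 0)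
  have hpp : positivePart f x = a x := by
    rw [positivePart, ha x hx, max_eq_left (by linarith)]
  obtain ⟨z, ⟨hz, hzW⟩, hxz⟩ := H' x (B + |a 0| + a x) (by linarith [abs_nonneg (a 0)])
    (Or.inr ⟨0, by simp⟩)
    ⟨by linarith [affineMap_apply_eq a x], fun k => by
      linarith [(hmem x).1 hx k, hB k, abs_nonneg (a 0)]⟩
  have h1 := hD z hz (fun w hw t ht =>
    (hmem _).2 (ray_mem_of_forall_le_zero ((hmem w).1 hw) hzW ht)) ⟨x, hx⟩
  have h2 := Metric.infDist_le_infDist_add_dist (s := zeroSublevel f) (x := x) (y := z)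
  rw [dist_eq_norm] at h2
  have h3 : 1 ≤ a x / δ := (one_le_div hδ).2 hax
  have h4 : D ≤ D / δ * a x := by
    calc D = D * 1 := (mul_one D).symm
      _ ≤ D * (a x / δ) := by gcongr
      _ = _ := by ring
  have h5 : C' * (B + |a 0| + a x) ≤ C' * ((B + |a 0|) / δ + 1) * a x := by
    have : (B + |a 0|) * 1 ≤ (B + |a 0|) * (a x / δ) := by gcongr
    calc C' * (B + |a 0| + a x) ≤ C' * ((B + |a 0|) * (a x / δ) + a x) := by gcongr; linarith
      _ = _ := by ring
  rw [hpp]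
  linarith

end PAErrorBound

theorem mainTheorem1 {E : Type*} [NormedAddCommGroup E] [NormedSpace ℝ E] [FiniteDimensional ℝ E]
    (f : E → ℝ) (hf : PAErrorBound.IsPiecewiseAffine f)
    (hS : (PAErrorBound.zeroSublevel f).Nonempty)
    (V : Set E) (hV : PAErrorBound.IsFiniteUnionPolyhedral V) :
    (∀ x : E, Tendsto (fun t : ℝ => PAErrorBound.positivePart f (t • x) / t) atTop
      (𝓝 (PAErrorBound.recessionFunction (PAErrorBound.positivePart f) x))) ∧
    (PAErrorBound.HasErrorBoundOn f V ↔
      PAErrorBound.zeroSublevel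
          (PAErrorBound.recessionFunction (PAErrorBound.positivePart f)) ∩
        PAErrorBound.recessionCone V ⊆
      PAErrorBound.recessionCone (PAErrorBound.zeroSublevel f)) := by
  open PAErrorBound in
  obtain ⟨n, Q, g, ⟨hQ, hU, -, -⟩, hg⟩ := hf
  obtain ⟨N, P, hP, rfl⟩ := hV
  choose s hs using exists_tendsto_ray_div hQ hU hg
  have hlim := fun z => tendsto_positivePart_div (hs z 0)
  have hrec : ∀ z, recessionFunction (positivePart f) z = max (s z) 0 :=
    fun z => (hlim z).limUnder_eq
  have hsub : ∀ z, z ∈ zeroSublevel (recessionFunction (positivePart f)) ↔ s z ≤ 0 := by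
    intro z
    simp [zeroSublevel, hrec]
  refine ⟨fun z => hrec z ▸ hlim z, fun hEB => ?_, fun hincl => ?_⟩
  · rintro z ⟨hz, x, -, hx⟩
    exact mem_recessionCone_of_hasErrorBoundOn hQ hU hg hS hEB hx (hs z x) ((hsub z).1 hz)
  · have hSeq := zeroSublevel_eq_iUnion hU hg
    obtain ⟨D, hD0, hD⟩ := exists_infDist_le_of_recessionCone
      fun i => (hQ i).inter (isPolyhedral_affine_le_zero (g i))
    rw [← hSeq] at hD
    -- Refining V by the pieces Q i makes f affine on each member of the cover.
    have hcover : ⋃ i, P i = ⋃ ji : Fin N × Fin n, P ji.1 ∩ Q ji.2 := by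
      rw [Set.iUnion_prod', ← Set.inter_univ (⋃ i, P i), ← hU, Set.iUnion_inter_iUnion]
    rw [hcover]
    refine HasErrorBoundOn.iUnion fun ⟨j, i⟩ => hasErrorBoundOn_of_affine_piece
      ((hP j).inter (hQ i)) (fun x hx => hg i x hx.2) hD0 fun z hz hray ⟨w, hw⟩ => hD z ?_
    refine hincl ⟨(hsub z).2 ?_, w, Set.mem_iUnion_of_mem j hw.1,
      fun t ht => Set.mem_iUnion_of_mem j (hray w hw t ht).1⟩
    -- The ray from w stays in one piece, so s z is the slope of that piece.
    have hslope : ∀ᶠ t : ℝ in atTop, f (w + t • z) = g i w + t * (g i).linear z := by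
      filter_upwards [eventually_ge_atTop 0] with t ht
      rw [hg i _ (hray w hw t ht).2, affineMap_apply_ray]
    exact (tendsto_nhds_unique (hs z w) (tendsto_div_atTop_of_eventually_eq_affine hslope)).trans_le hz
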